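/- Let $\mathcal S,\mathcal A$ be finite sets and consider a Markov decision process with transition probabilities $p(s'\mid s,a)$, discount factor $\gamma\in(0,1)$, expected rewards $r(s,a)\in\mathbb R$ and initial state distribution $\rho$. A policy $\pi$ assigns to every state $s$ a probability distribution $\pi(\cdot\mid s)$ on $\mathcal A$; under $\pi$ a trajectory $(S_0,A_0,S_1,A_1,\dots)$ has $S_0\sim\rho$, $A_t\sim\pi(\cdot\mid S_t)$ and $S_{t+1}\sim p(\cdot\mid S_t,A_t)$. Put $$J(\pi)=(1-\gamma)\,\mathbb E_\pi\Big[\sum_{t\ge0}\gamma^t r(S_t,A_t)\Big],\qquad q_{\pi,\gamma}(s,a)=\mathbb E_\pi\Big[\sum_{t\ge0}\gamma^t r(S_t,A_t)\,\Big|\,S_0=s,A_0=a\Big],$$ and $p_\pi(s'\mid s)=\sum_a\pi(a\mid s)p(s'\mid s,a)$. The undiscounted stationary distribution $d_\pi$ and the discounted stationary distribution $d_{\pi,\gamma}$ are the probability distributions on $\mathcal S$ with, for all $s'$, $$\sum_s d_\pi(s)\,p_\pi(s'\mid s)=d_\pi(s'),\qquad \sum_s d_{\pi,\gamma}(s)\big[\gamma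 p_\pi(s'\mid s)+(1-\gamma)\rho(s')\big]=d_{\pi,\gamma}(s').$$ The averaging correction is $$c_\pi(s)=\lim_{T\to\infty}c_{\pi,T}(s),\qquad c_{\pi,T}(s)=\mathbb E_\pi\left[(1-\gamma)\,T\,\frac{\sum_{t=0}^{T-1}\gamma^t\mathbf 1[S_t=s]}{\sum_{k=0}^{T-1}\mathbf 1[S_k=s]}\right],$$ where the quotient is read as $0$ on trajectories that do not visit $s$ before time $T$. Theorem (Extended Policy Gradient Theorem). Let $(\pi_\theta)_{\theta\in\mathbb R^n}$ be a family of policies, let $\theta\in\mathbb R^n$ be such that every $\vartheta\mapsto\pi_\vartheta(a\mid s)$ is differentiable at $\theta$, and write $\pi=\pi_\theta$. Suppose that the state chain under $\pi$ is irreducible (from every state, every state has positive probability at some time) and that every state $s$ is positive recurrent, i.e. $\mathbb E_\pi[\min\{t>0:S_t=s\}\mid S_0=s]<\infty$. Then 1. $d_\pi$ and $d_{\pi,\gamma}$ exist and are unique, and $d_\pi(s)>0$ for every $s$; 2. for every $s$ the limit $c_\pi(s)$ exists in $\mathbb R$, and $c_\pi(s)=d_{\pi,\gamma}(s)/d_\pi(s)$;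 3. $\vartheta\mapsto J(\pi_\vartheta)$ is differentiable at $\theta$, and, with all gradients taken in the parameter at $\theta$, $$\nabla J(\pi)=\mathbb E_{S\sim d_{\pi,\gamma}}\Big[\sum_{a}\nabla\pi(a\mid S)\,q_{\pi,\gamma}(S,a)\Big]=\mathbb E_{S\sim d_\pi}\Big[c_\pi(S)\sum_{a}\nabla\pi(a\mid S)\,q_{\pi,\gamma}(S,a)\Big].$$ -/

import Mathlib

open MeasureTheory ProbabilityTheory Filter Topology
open scoped ENNReal

/-- A finite Markov decision process: transition probabilities `p(s' | s, a)`, discount factor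
`γ ∈ (0, 1)`, expected rewards `r(s, a)` and initial state distribution `ρ`. -/
structure MDP (𝒮 𝒜 : Type*) where
  p : 𝒮 → 𝒜 → PMF 𝒮
  γ : ℝ
  γ_pos : 0 < γ
  γ_lt_one : γ < 1
  r : 𝒮 → 𝒜 → ℝ
  ρ : PMF 𝒮

/-- A stationary randomized policy: `π s` is the distribution `π(· | s)` on actions. -/
abbrev Policy (𝒮 𝒜 : Type*) := 𝒮 → PMF 𝒜

namespace MDP

noncomputable section

variable {𝒮 𝒜 : Type*} (M : MDP 𝒮 𝒜) (π : Policy 𝒮 𝒜)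

/-- Law of `(S, A)` when `S ~ μ` and `A ~ π(· | S)`. -/
def withAction (π : Policy 𝒮 𝒜) (μ : PMF 𝒮) : PMF (𝒮 × 𝒜) :=
  μ.bind fun s => (π s).map fun a => (s, a)

section Trajectory

variable [Fintype 𝒮] [MeasurableSpace 𝒮] [DiscreteMeasurableSpace 𝒮]
  [Fintype 𝒜] [MeasurableSpace 𝒜] [DiscreteMeasurableSpace 𝒜]

/-- One step of the state-action chain: from `(s, a)`, draw `s' ~ p(· | s, a)` and then
`a' ~ π(· | s')`. -/
def step : Kernel (𝒮 × 𝒜) (𝒮 × 𝒜) where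
  toFun x := (withAction π (M.p x.1 x.2)).toMeasure
  measurable' := Measurable.of_discrete

instance : IsMarkovKernel (M.step π) where
  isProbabilityMeasure x := PMF.toMeasure.isProbabilityMeasure (withAction π (M.p x.1 x.2))

/-- Law of the trajectory `(S_0, A_0), (S_1, A_1), …` when `(S_0, A_0) ~ μ` and every later pair
is drawn from `step`. A trajectory `ω` has `S_t = (ω t).1` and `A_t = (ω t).2`. -/
def trajFrom (μ : PMF (𝒮 × 𝒜)) : Measure (ℕ → 𝒮 × 𝒜) :=
  Kernel.trajMeasure (X := fun _ => 𝒮 × 𝒜) μ.toMeasure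
    fun n => (M.step π).comap (fun h => h ⟨n, Finset.mem_Iic.2 le_rfl⟩) (measurable_pi_apply _)

/-- Law of the trajectory with `S_0 ~ ρ` under `π`. -/
def traj : Measure (ℕ → 𝒮 × 𝒜) := M.trajFrom π (withAction π M.ρ)

/-- Law of the trajectory with `S_0 = s` under `π`. -/
def trajState (s : 𝒮) : Measure (ℕ → 𝒮 × 𝒜) := M.trajFrom π (withAction π (PMF.pure s))

/-- The discounted return `∑ₜ γᵗ r(S_t, A_t)` of a trajectory. -/
def discountedReturn (ω : ℕ → 𝒮 × 𝒜) : ℝ := ∑' t : ℕ, M.γ ^ t * M.r (ω t).1 (ω t).2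

/-- The objective `J(π) = (1 - γ) E_π[∑ₜ γᵗ r(S_t, A_t)]` with `S_0 ~ ρ`. -/
def J : ℝ := (1 - M.γ) * ∫ ω, M.discountedReturn ω ∂(M.traj π)

/-- The action value `q_{π,γ}(s, a) = E_π[∑ₜ γᵗ r(S_t, A_t) | S_0 = s, A_0 = a]`. -/
def q (s : 𝒮) (a : 𝒜) : ℝ := ∫ ω, M.discountedReturn ω ∂(M.trajFrom π (PMF.pure (s, a)))

/-- From every state, every state is reached with positive probability at some time. -/
def IsIrreducible : Prop := ∀ s s' : 𝒮, ∃ t : ℕ, 0 < M.trajState π s {ω | (ω t).1 = s'}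

/-- `τ⁺(s) = min {t > 0 : S_t = s}`, which is `∞` if there is no such `t`. -/
def recurrenceTime (s : 𝒮) (ω : ℕ → 𝒮 × 𝒜) : ℝ≥0∞ :=
  ⨅ t : {t : ℕ // 0 < t ∧ (ω t).1 = s}, (t : ℝ≥0∞)

/-- The expected recurrence time of `s` for the chain started in `s` is finite. -/
def IsPositiveRecurrent (s : 𝒮) : Prop := ∫⁻ ω, recurrenceTime s ω ∂(M.trajState π s) < ∞

open Classical in
/-- `c_T(s, ω) = (∑_{t<T} γᵗ 1[S_t = s]) / (∑_{k<T} 1[S_k = s])`, which is `0` if `s` is not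
visited before time `T`. -/
def trajCorrection (T : ℕ) (s : 𝒮) (ω : ℕ → 𝒮 × 𝒜) : ℝ :=
  (∑ t ∈ Finset.range T, M.γ ^ t * (if (ω t).1 = s then 1 else 0)) /
    ∑ k ∈ Finset.range T, (if (ω k).1 = s then 1 else 0)

/-- `c_{π,T}(s) = E_π[(1 - γ) T c_T(s, ·)]` with `S_0 ~ ρ`. -/
def finiteCorrection (T : ℕ) (s : 𝒮) : ℝ :=
  ∫ ω, (1 - M.γ) * T * M.trajCorrection T s ω ∂(M.traj π)

/-- The averaging correction `c_π(s) = lim_{T → ∞} c_{π,T}(s)`. -/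
def averagingCorrection (s : 𝒮) : ℝ := limUnder atTop fun T => M.finiteCorrection π T s

end Trajectory

section Stationary

variable [Fintype 𝒮] [Fintype 𝒜]

/-- The state transition probability `p_π(s' | s) = ∑ₐ π(a | s) p(s' | s, a)`. -/
def stateTransition (s s' : 𝒮) : ℝ := ∑ a, (π s a).toReal * (M.p s a s').toReal

/-- `d` is an undiscounted stationary distribution: `∑ₛ d(s) p_π(s' | s) = d(s')`. -/
def IsStationary (d : 𝒮 → ℝ) : Prop :=
  d ∈ stdSimplex ℝ 𝒮 ∧ ∀ s', ∑ s, d s * M.stateTransition π s s' = d s'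

/-- `d` is a discounted stationary distribution:
`∑ₛ d(s) (γ p_π(s' | s) + (1 - γ) ρ(s')) = d(s')`. -/
def IsDiscountedStationary (d : 𝒮 → ℝ) : Prop :=
  d ∈ stdSimplex ℝ 𝒮 ∧
    ∀ s', ∑ s, d s * (M.γ * M.stateTransition π s s' + (1 - M.γ) * (M.ρ s').toReal) = d s'

end Stationary

end

end MDP

/-! The gradient formula rests on one balance identity: if `v = b + γ P v`, pairing with the
discounted stationary `d` gives `(1 - γ) ρ · v = d · b` (`IsDiscountedStationary.sum_mul_eq`). For
`v` a difference of two state values this is the performance difference identity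
(`IsDiscountedStationary.J_sub_J`), in which `J π' - J π` is a sum of terms `(π' - π) * q_{π'}`
weighted by the distribution of `π`. Along `π' = π ϑ`, each term is a differentiable factor
vanishing at `θ` times a factor that is merely continuous there (`continuousAt_q`), so the gradient
is read off without differentiating `q`.

For the averaging correction, let `D` and `N` be the discounted and plain visit counts. Where `N /
T` is near `d s`, the quantity `(1 - γ) T D / N` is near `(1 - γ) D / d s`, whose mean tends to `dγ
s / d s`. Elsewhere it is only bounded by a multiple of `T`, so a law of large numbers does not
suffice: the deviation probability must be `o(1 / T)`. Irreducibility makes the Poisson equation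
solvable (`IsIrreducible.exists_sub_stateOp_eq`), without any aperiodicity. Its solution turns `N -
d s * T` into a martingale with bounded increments, up to a bounded boundary term, and exponential
moments (`integral_exp_le`) give exponentially small tails. -/

namespace MDP

variable {𝒮 𝒜 : Type*}

/-! ### Averaging operators and the discounted balance identity -/

section Operators

variable [Fintype 𝒜] (M : MDP 𝒮 𝒜) (π : Policy 𝒮 𝒜)

/-- The mean of `ψ (s, A)` over `A ~ π(· | s)`. -/
noncomputable def expAct (ψ : 𝒮 × 𝒜 → ℝ) (s : 𝒮) : ℝ := ∑ a, (π s a).toReal * ψ (s, a)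

theorem sum_toReal_eq_one {α : Type*} [Fintype α] (μ : PMF α) : ∑ a, (μ a).toReal = 1 := by
  rw [← ENNReal.toReal_sum fun a _ => μ.apply_ne_top a, ← tsum_fintype (L := .unconditional _),
    μ.tsum_coe, ENNReal.toReal_one]

theorem withAction_apply (μ : PMF 𝒮) (s : 𝒮) (a : 𝒜) :
    withAction π μ (s, a) = μ s * π s a := by
  classical
  simp only [withAction, PMF.bind_apply, PMF.map_apply, Prod.mk.injEq]
  rw [tsum_eq_single s]
  · congr 1
    rw [tsum_eq_single a] <;> simp +contextual [eq_comm]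
  · intro s' hs'
    simp [hs'.symm]

theorem expAct_comp_fst (φ : 𝒮 → ℝ) (s : 𝒮) : expAct π (fun x => φ x.1) s = φ s := by
  simp [expAct, ← Finset.sum_mul, sum_toReal_eq_one]

theorem expAct_add (ψ ψ' : 𝒮 × 𝒜 → ℝ) (s : 𝒮) :
    expAct π (fun x => ψ x + ψ' x) s = expAct π ψ s + expAct π ψ' s := by
  simp [expAct, mul_add, Finset.sum_add_distrib]

theorem expAct_const_mul (c : ℝ) (ψ : 𝒮 × 𝒜 → ℝ) (s : 𝒮) :
    expAct π (fun x => c * ψ x) s = c * expAct π ψ s := by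
  simp only [expAct, Finset.mul_sum, mul_left_comm]

theorem abs_sum_toReal_mul_le {α : Type*} [Fintype α] (μ : PMF α) {φ : α → ℝ} {C : ℝ}
    (h : ∀ a, |φ a| ≤ C) : |∑ a, (μ a).toReal * φ a| ≤ C := by
  calc |∑ a, (μ a).toReal * φ a| ≤ ∑ a, |(μ a).toReal * φ a| := Finset.abs_sum_le_sum_abs _ _
    _ ≤ ∑ a, (μ a).toReal * C := by
        refine Finset.sum_le_sum fun a _ => ?_
        rw [abs_mul, abs_of_nonneg ENNReal.toReal_nonneg]
        exact mul_le_mul_of_nonneg_left (h a) ENNReal.toReal_nonneg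
    _ = C := by rw [← Finset.sum_mul, sum_toReal_eq_one, one_mul]

theorem stateTransition_nonneg (s s' : 𝒮) : 0 ≤ M.stateTransition π s s' :=
  Finset.sum_nonneg fun _ _ => mul_nonneg ENNReal.toReal_nonneg ENNReal.toReal_nonneg

variable [Fintype 𝒮]

/-- The mean of `φ S'` over `S' ~ p(· | s, a)`. -/
noncomputable def expNext (φ : 𝒮 → ℝ) (x : 𝒮 × 𝒜) : ℝ :=
  ∑ s', (M.p x.1 x.2 s').toReal * φ s'

/-- The transition operator of the state-action chain. -/
noncomputable def stepOp (ψ : 𝒮 × 𝒜 → ℝ) : 𝒮 × 𝒜 → ℝ := M.expNext (expAct π ψ)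

theorem sum_withAction (μ : PMF 𝒮) (ψ : 𝒮 × 𝒜 → ℝ) :
    ∑ x, (withAction π μ x).toReal * ψ x = ∑ s, (μ s).toReal * expAct π ψ s := by
  rw [Fintype.sum_prod_type]
  refine Finset.sum_congr rfl fun s _ => ?_
  rw [expAct, Finset.mul_sum]
  refine Finset.sum_congr rfl fun a _ => ?_
  rw [withAction_apply, ENNReal.toReal_mul, mul_assoc]

theorem expAct_expNext (φ : 𝒮 → ℝ) (s : 𝒮) :
    expAct π (M.expNext φ) s = ∑ s', M.stateTransition π s s' * φ s' := by
  simp only [expAct, expNext, stateTransition, Finset.mul_sum, Finset.sum_mul]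
  rw [Finset.sum_comm]
  simp only [mul_assoc]

theorem stepOp_eq_sum (ψ : 𝒮 × 𝒜 → ℝ) (x : 𝒮 × 𝒜) :
    M.stepOp π ψ x = ∑ y, (withAction π (M.p x.1 x.2) y).toReal * ψ y :=
  (sum_withAction π _ ψ).symm

theorem abs_iterate_stepOp_le {ψ : 𝒮 × 𝒜 → ℝ} {C : ℝ} (h : ∀ x, |ψ x| ≤ C) (t : ℕ)
    (x : 𝒮 × 𝒜) : |(M.stepOp π)^[t] ψ x| ≤ C := by
  induction t generalizing x with
  | zero => exact h x
  | succ t ih =>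
    rw [Function.iterate_succ_apply', stepOp_eq_sum]
    exact abs_sum_toReal_mul_le _ ih

theorem sum_stateTransition (s : 𝒮) : ∑ s', M.stateTransition π s s' = 1 := by
  have := M.expAct_expNext π (fun _ => 1) s
  simpa [expAct, expNext, sum_toReal_eq_one] using this.symm

theorem exists_abs_le {α : Type*} [Finite α] (f : α → ℝ) : ∃ C, 0 ≤ C ∧ ∀ a, |f a| ≤ C := by
  have := Fintype.ofFinite α
  exact ⟨∑ a, |f a|, Finset.sum_nonneg fun _ _ => abs_nonneg _, fun a =>
    Finset.single_le_sum (f := fun a => |f a|) (fun x _ => abs_nonneg _) (Finset.mem_univ _)⟩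

theorem summable_discounted_iterate (x : 𝒮 × 𝒜) :
    Summable fun t : ℕ => M.γ ^ t * (M.stepOp π)^[t] (fun y => M.r y.1 y.2) x := by
  obtain ⟨C, hC, h⟩ := exists_abs_le fun y : 𝒮 × 𝒜 => M.r y.1 y.2
  refine Summable.of_norm_bounded (g := fun t => M.γ ^ t * C)
    ((summable_geometric_of_lt_one M.γ_pos.le M.γ_lt_one).mul_right C) fun t => ?_
  rw [Real.norm_eq_abs, abs_mul, abs_of_pos (pow_pos M.γ_pos t)]
  exact mul_le_mul_of_nonneg_left (M.abs_iterate_stepOp_le π h t x) (pow_pos M.γ_pos t).le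

variable {M π}

/-- If `v = b + γ P v` then `(1 - γ) ρ · v = d · b` for the discounted stationary `d`. -/
theorem IsDiscountedStationary.sum_mul_eq {d : 𝒮 → ℝ} (hd : M.IsDiscountedStationary π d)
    {b v : 𝒮 → ℝ} (h : ∀ s, v s = b s + M.γ * ∑ s', M.stateTransition π s s' * v s') :
    (1 - M.γ) * ∑ s, (M.ρ s).toReal * v s = ∑ s, d s * b s := by
  have h1 : ∑ s', d s' * v s' = M.γ * ∑ s, d s * ∑ s', M.stateTransition π s s' * v s' +
      (1 - M.γ) * ∑ s', (M.ρ s').toReal * v s' := by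
    calc ∑ s', d s' * v s' = ∑ s', ∑ s, d s * (M.γ * M.stateTransition π s s' +
          (1 - M.γ) * (M.ρ s').toReal) * v s' := by
          refine Finset.sum_congr rfl fun s' _ => ?_
          rw [← Finset.sum_mul, hd.2]
      _ = ∑ s, d s * (M.γ * ∑ s', M.stateTransition π s s' * v s' +
          (1 - M.γ) * ∑ s', (M.ρ s').toReal * v s') := by
          rw [Finset.sum_comm]
          refine Finset.sum_congr rfl fun s _ => ?_
          simp only [Finset.mul_sum, ← Finset.sum_add_distrib]
          exact Finset.sum_congr rfl fun s' _ => by ring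
      _ = _ := by
          simp only [mul_add, Finset.sum_add_distrib]
          rw [← Finset.sum_mul, hd.1.2, one_mul, add_left_inj, Finset.mul_sum]
          exact Finset.sum_congr rfl fun s' _ => by ring
  have h2 : ∑ s, d s * v s = ∑ s, d s * b s +
      M.γ * ∑ s, d s * ∑ s', M.stateTransition π s s' * v s' := by
    rw [Finset.mul_sum, ← Finset.sum_add_distrib]
    refine Finset.sum_congr rfl fun s _ => ?_
    conv_lhs => rw [h s]
    ring
  linarith

end Operators

/-! ### Trajectory expectations and the Bellman equation -/

section Trajectory

variable [Fintype 𝒮] [MeasurableSpace 𝒮] [DiscreteMeasurableSpace 𝒮]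
  [Fintype 𝒜] [MeasurableSpace 𝒜] [DiscreteMeasurableSpace 𝒜]
  (M : MDP 𝒮 𝒜) (π : Policy 𝒮 𝒜)

instance (μ : PMF (𝒮 × 𝒜)) : IsProbabilityMeasure (M.trajFrom π μ) := by
  unfold trajFrom; infer_instance

theorem integral_step (x : 𝒮 × 𝒜) (ψ : 𝒮 × 𝒜 → ℝ) : ∫ y, ψ y ∂(M.step π x) = M.stepOp π ψ x := by
  rw [stepOp_eq_sum]
  exact PMF.integral_eq_sum _ _

/-- The Markov property. -/
theorem integral_history_mul_succ (μ : PMF (𝒮 × 𝒜)) (t : ℕ)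
    (F : (Finset.Iic t → 𝒮 × 𝒜) → ℝ) (ψ : 𝒮 × 𝒜 → ℝ) :
    ∫ ω, F (Preorder.frestrictLe (π := fun _ => 𝒮 × 𝒜) t ω) * ψ (ω (t + 1)) ∂(M.trajFrom π μ) =
      ∫ ω, F (Preorder.frestrictLe (π := fun _ => 𝒮 × 𝒜) t ω) * M.stepOp π ψ (ω t)
        ∂(M.trajFrom π μ) := by
  classical
  set κ : (n : ℕ) → Kernel (Finset.Iic n → 𝒮 × 𝒜) (𝒮 × 𝒜) :=
    fun n => (M.step π).comap (fun h => h ⟨n, Finset.mem_Iic.2 le_rfl⟩) (measurable_pi_apply _)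
    with hκ
  have key := Kernel.map_frestrictLe_trajMeasure_compProd_eq_map_trajMeasure
    (X := fun _ => 𝒮 × 𝒜) (μ₀ := μ.toMeasure) (κ := κ) (a := t)
  have hν : M.trajFrom π μ = Kernel.trajMeasure (X := fun _ => 𝒮 × 𝒜) μ.toMeasure κ := rfl
  rw [← hν] at key
  have hm : Measurable (fun z : (Finset.Iic t → 𝒮 × 𝒜) × (𝒮 × 𝒜) => F z.1 * ψ z.2) :=
    Measurable.of_discrete
  have hmap : ∫ ω, F (Preorder.frestrictLe (π := fun _ => 𝒮 × 𝒜) t ω) * ψ (ω (t + 1))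
        ∂(M.trajFrom π μ) =
      ∫ z, F z.1 * ψ z.2 ∂((M.trajFrom π μ).map
        (fun x => (Preorder.frestrictLe (π := fun _ => 𝒮 × 𝒜) t x, x (t + 1)))) := by
    rw [integral_map (by fun_prop) hm.aestronglyMeasurable]
  rw [hmap, ← key, Measure.integral_compProd .of_finite, integral_map (by fun_prop)
    (Measurable.of_discrete.aestronglyMeasurable)]
  refine integral_congr_ae (Eventually.of_forall fun ω => ?_)
  simp only [integral_const_mul]
  congr 1
  exact M.integral_step π (ω t) ψ

theorem integral_coord_zero (μ : PMF (𝒮 × 𝒜)) (ψ : 𝒮 × 𝒜 → ℝ) :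
    ∫ ω, ψ (ω 0) ∂(M.trajFrom π μ) = ∑ x, (μ x).toReal * ψ x := by
  have hψ : Measurable ψ := .of_discrete
  have h : (M.trajFrom π μ).map (Preorder.frestrictLe (π := fun _ => 𝒮 × 𝒜) 0) =
      μ.toMeasure.map (MeasurableEquiv.piUnique (fun _ : Finset.Iic 0 => 𝒮 × 𝒜)).symm := by
    unfold trajFrom Kernel.trajMeasure
    rw [Measure.map_comp _ _ (by fun_prop), Kernel.traj_map_frestrictLe, Kernel.partialTraj_self]
    exact Measure.id_comp
  have h' : (M.trajFrom π μ).map (fun ω => ω 0) = μ.toMeasure := by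
    have e : (fun ω : ℕ → 𝒮 × 𝒜 => ω 0) =
        (fun f : Finset.Iic 0 → 𝒮 × 𝒜 => f ⟨0, Finset.mem_Iic.2 le_rfl⟩) ∘
          Preorder.frestrictLe (π := fun _ => 𝒮 × 𝒜) 0 := rfl
    rw [e, ← Measure.map_map (measurable_pi_apply _) (by fun_prop), h,
      Measure.map_map (measurable_pi_apply _) (MeasurableEquiv.measurable _)]
    exact Measure.map_id
  rw [← integral_map (φ := fun ω : ℕ → 𝒮 × 𝒜 => ω 0) (measurable_pi_apply 0).aemeasurable
    hψ.aestronglyMeasurable, h']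
  exact PMF.integral_eq_sum _ _

theorem integrable_comp_coord (μ : PMF (𝒮 × 𝒜)) (t : ℕ) (ψ : 𝒮 × 𝒜 → ℝ) :
    Integrable (fun ω => ψ (ω t)) (M.trajFrom π μ) := by
  have : Measurable ψ := .of_discrete
  refine Integrable.of_bound (C := ∑ x, |ψ x|)
    (this.comp (measurable_pi_apply t)).aestronglyMeasurable (Eventually.of_forall fun ω => ?_)
  exact Finset.single_le_sum (f := fun x => |ψ x|) (fun x _ => abs_nonneg _) (Finset.mem_univ _)

theorem integral_coord (μ : PMF (𝒮 × 𝒜)) (t : ℕ) (ψ : 𝒮 × 𝒜 → ℝ) :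
    ∫ ω, ψ (ω t) ∂(M.trajFrom π μ) = ∑ x, (μ x).toReal * (M.stepOp π)^[t] ψ x := by
  induction t generalizing ψ with
  | zero => exact M.integral_coord_zero π μ ψ
  | succ t ih =>
    rw [Function.iterate_succ_apply, ← ih]
    simpa using M.integral_history_mul_succ π μ t (fun _ => 1) ψ

theorem integral_discountedReturn (μ : PMF (𝒮 × 𝒜)) :
    ∫ ω, M.discountedReturn ω ∂(M.trajFrom π μ) =
      ∑ x, (μ x).toReal *
        ∑' t : ℕ, M.γ ^ t * (M.stepOp π)^[t] (fun y => M.r y.1 y.2) x := by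
  obtain ⟨C, hC, h⟩ := exists_abs_le fun y : 𝒮 × 𝒜 => M.r y.1 y.2
  have hint : ∀ t : ℕ, Integrable (fun ω : ℕ → 𝒮 × 𝒜 => M.γ ^ t * M.r (ω t).1 (ω t).2)
      (M.trajFrom π μ) := fun t =>
    (M.integrable_comp_coord π μ t fun y => M.r y.1 y.2).const_mul _
  unfold discountedReturn
  rw [← integral_tsum_of_summable_integral_norm hint]
  · simp_rw [← tsum_mul_left]
    rw [← Summable.tsum_finsetSum fun x _ => (M.summable_discounted_iterate π x).mul_left _]
    refine tsum_congr fun t => ?_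
    rw [integral_const_mul, M.integral_coord π μ t fun y => M.r y.1 y.2, Finset.mul_sum]
    exact Finset.sum_congr rfl fun x _ => by ring
  · refine Summable.of_nonneg_of_le (fun t => integral_nonneg fun ω => norm_nonneg _)
      (fun t => ?_) ((summable_geometric_of_lt_one M.γ_pos.le M.γ_lt_one).mul_right C)
    calc ∫ ω, ‖M.γ ^ t * M.r (ω t).1 (ω t).2‖ ∂(M.trajFrom π μ)
        ≤ ∫ ω, M.γ ^ t * C ∂(M.trajFrom π μ) := by
          refine integral_mono (hint t).norm (integrable_const _) fun ω => ?_
          simp only [Real.norm_eq_abs]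
          rw [abs_mul, abs_of_pos (pow_pos M.γ_pos t)]
          exact mul_le_mul_of_nonneg_left (h _) (pow_pos M.γ_pos t).le
      _ = M.γ ^ t * C := by simp

theorem q_eq_tsum (s : 𝒮) (a : 𝒜) :
    M.q π s a = ∑' t : ℕ, M.γ ^ t * (M.stepOp π)^[t] (fun y => M.r y.1 y.2) (s, a) := by
  classical
  rw [q, integral_discountedReturn, Finset.sum_eq_single (s, a)] <;>
    simp +contextual [PMF.pure_apply]

theorem integral_discountedReturn_eq_sum_q (μ : PMF (𝒮 × 𝒜)) :
    ∫ ω, M.discountedReturn ω ∂(M.trajFrom π μ) = ∑ x, (μ x).toReal * M.q π x.1 x.2 := by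
  simp only [integral_discountedReturn, q_eq_tsum]

/-- The state value `∑ₐ π(a | s) q(s, a)`. -/
noncomputable def stateValue : 𝒮 → ℝ := expAct π fun x => M.q π x.1 x.2

theorem J_eq_sum_stateValue : M.J π = (1 - M.γ) * ∑ s, (M.ρ s).toReal * M.stateValue π s := by
  rw [J, traj, integral_discountedReturn_eq_sum_q, sum_withAction]
  rfl

/-- The Bellman equation. -/
theorem q_eq_add (s : 𝒮) (a : 𝒜) :
    M.q π s a = M.r s a + M.γ * M.expNext (M.stateValue π) (s, a) := by
  have hs := M.summable_discounted_iterate π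
  rw [q_eq_tsum, (hs (s, a)).tsum_eq_zero_add]
  congr 1
  · simp
  · have : M.expNext (M.stateValue π) (s, a) =
        ∑ y, (withAction π (M.p s a) y).toReal * M.q π y.1 y.2 := (sum_withAction π _ _).symm
    rw [this]
    simp_rw [q_eq_tsum, ← tsum_mul_left]
    rw [← Summable.tsum_finsetSum fun y _ => (hs y).mul_left _, ← tsum_mul_left]
    refine tsum_congr fun t => ?_
    rw [Function.iterate_succ_apply', stepOp_eq_sum, Finset.mul_sum, Finset.mul_sum]
    exact Finset.sum_congr rfl fun x _ => by ring

theorem stateValue_eq (s : 𝒮) :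
    M.stateValue π s = expAct π (fun x => M.r x.1 x.2) s +
      M.γ * ∑ s', M.stateTransition π s s' * M.stateValue π s' := by
  rw [← expAct_expNext, ← expAct_const_mul, ← expAct_add]
  exact congrArg (fun f => expAct π f s) (funext fun x => M.q_eq_add π x.1 x.2)

variable {M π}

theorem IsDiscountedStationary.sum_mul_expAct {d : 𝒮 → ℝ} (hd : M.IsDiscountedStationary π d) :
    ∑ s, d s * expAct π (fun x => M.r x.1 x.2) s = M.J π := by
  rw [J_eq_sum_stateValue, hd.sum_mul_eq (M.stateValue_eq π)]

end Trajectory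
-- Existence of stationary distributions
theorem exists_stationary_of_stochastic {α : Type*} [Fintype α] [Nonempty α] {Q : α → α → ℝ}
    (h0 : ∀ i j, 0 ≤ Q i j) (h1 : ∀ i, ∑ j, Q i j = 1) :
    ∃ d ∈ stdSimplex ℝ α, ∀ j, ∑ i, d i * Q i j = d j := by
  classical
  -- Constants form a right null vector of `1 - Q`, so a left null vector `v` exists too, possibly
  -- of mixed sign.
  have hdet : (1 - Matrix.of Q).det = 0 := by
    rw [← Matrix.exists_mulVec_eq_zero_iff]
    refine ⟨fun _ => 1, fun h => one_ne_zero (congrFun h (Classical.arbitrary α)), ?_⟩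
    ext i
    rw [Matrix.sub_mulVec, Matrix.one_mulVec]
    simp [Matrix.mulVec, dotProduct, h1]
  obtain ⟨v, hv, hv0⟩ := Matrix.exists_vecMul_eq_zero_iff.2 hdet
  have hvQ : ∀ j, ∑ i, v i * Q i j = v j := fun j => by
    have := congrFun hv0 j
    rw [Matrix.vecMul_sub, Matrix.vecMul_one] at this
    exact (sub_eq_zero.1 this).symm
  have hle : ∀ j ∈ Finset.univ, |v j| ≤ ∑ i, |v i| * Q i j := fun j _ => by
    conv_lhs => rw [← hvQ j]
    refine (Finset.abs_sum_le_sum_abs _ _).trans_eq (Finset.sum_congr rfl fun i _ => ?_)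
    rw [abs_mul, abs_of_nonneg (h0 i j)]
  have hsum : ∑ j, |v j| = ∑ j, ∑ i, |v i| * Q i j := by
    rw [Finset.sum_comm]
    simp only [← Finset.mul_sum, h1, mul_one]
  -- `|v| ≤ |v| Q` pointwise and both sides have the same total mass, so `|v|` is itself invariant
  -- and only needs normalising.
  have heq := (Finset.sum_eq_sum_iff_of_le hle).1 hsum
  have hpos : 0 < ∑ j, |v j| := by
    obtain ⟨j, hj⟩ := Function.ne_iff.1 hv
    exact Finset.sum_pos' (fun _ _ => abs_nonneg _) ⟨j, Finset.mem_univ _, abs_pos.2 hj⟩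
  refine ⟨fun i => |v i| / ∑ j, |v j|, ⟨fun i => by positivity, ?_⟩, fun j => ?_⟩
  · rw [← Finset.sum_div, div_self hpos.ne']
  · simp only [div_mul_eq_mul_div, ← Finset.sum_div]
    rw [← heq j (Finset.mem_univ _)]

section Stationary

variable {𝒮 𝒜 : Type*} [Fintype 𝒮] [Fintype 𝒜] (M : MDP 𝒮 𝒜) (π : Policy 𝒮 𝒜)

theorem exists_isStationary [Nonempty 𝒮] : ∃ d, M.IsStationary π d :=
  exists_stationary_of_stochastic (M.stateTransition_nonneg π) (M.sum_stateTransition π)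

theorem exists_isDiscountedStationary [Nonempty 𝒮] : ∃ d, M.IsDiscountedStationary π d := by
  refine exists_stationary_of_stochastic (fun s s' => ?_) fun s => ?_
  · exact add_nonneg (mul_nonneg M.γ_pos.le (M.stateTransition_nonneg π s s'))
      (mul_nonneg (sub_nonneg.2 M.γ_lt_one.le) ENNReal.toReal_nonneg)
  · rw [Finset.sum_add_distrib, ← Finset.mul_sum, ← Finset.mul_sum, sum_stateTransition,
      sum_toReal_eq_one]
    ring

/-- The transition operator of the state chain. -/
noncomputable def stateOp (φ : 𝒮 → ℝ) : 𝒮 → ℝ := expAct π (M.expNext φ)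

theorem stateOp_apply (φ : 𝒮 → ℝ) (s : 𝒮) :
    M.stateOp π φ s = ∑ s', M.stateTransition π s s' * φ s' := M.expAct_expNext π φ s

/-- Averaging out the action intertwines the state-action operator with the state operator. -/
theorem expAct_iterate_stepOp (φ : 𝒮 → ℝ) (t : ℕ) :
    expAct π ((M.stepOp π)^[t] fun x => φ x.1) = (M.stateOp π)^[t] φ := by
  have h : Function.Semiconj (expAct π) (M.stepOp π) (M.stateOp π) := fun _ => rfl
  rw [h.iterate_right t]
  exact congrArg _ (funext (expAct_comp_fst π φ))

variable {M π}

theorem IsStationary.sum_mul_stateOp {d : 𝒮 → ℝ} (hd : M.IsStationary π d) (φ : 𝒮 → ℝ) :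
    ∑ s, d s * M.stateOp π φ s = ∑ s, d s * φ s := by
  simp only [stateOp_apply, Finset.mul_sum]
  rw [Finset.sum_comm]
  refine Finset.sum_congr rfl fun s' _ => ?_
  rw [← hd.2 s', Finset.sum_mul]
  simp only [mul_assoc]

theorem IsStationary.sum_mul_iterate_stateOp {d : 𝒮 → ℝ} (hd : M.IsStationary π d) (φ : 𝒮 → ℝ)
    (t : ℕ) : ∑ s, d s * (M.stateOp π)^[t] φ s = ∑ s, d s * φ s := by
  induction t with
  | zero => rfl
  | succ t ih => rw [Function.iterate_succ_apply', hd.sum_mul_stateOp, ih]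

end Stationary

/-! ### Irreducibility: harmonic functions, positivity, Poisson equation, uniqueness -/

section Irreducible

variable {𝒮 𝒜 : Type*} [Fintype 𝒮] [MeasurableSpace 𝒮] [DiscreteMeasurableSpace 𝒮]
  [Fintype 𝒜] [MeasurableSpace 𝒜] [DiscreteMeasurableSpace 𝒜] {M : MDP 𝒮 𝒜} {π : Policy 𝒮 𝒜}

instance (s : 𝒮) : IsProbabilityMeasure (M.trajState π s) := by unfold trajState; infer_instance

instance : IsProbabilityMeasure (M.traj π) := by unfold traj; infer_instance

variable (M π) in
theorem integral_trajState (s : 𝒮) (t : ℕ) (φ : 𝒮 → ℝ) :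
    ∫ ω, φ (ω t).1 ∂(M.trajState π s) = (M.stateOp π)^[t] φ s := by
  classical
  rw [trajState, M.integral_coord π _ t fun x => φ x.1, sum_withAction, expAct_iterate_stepOp,
    Finset.sum_eq_single s] <;> simp +contextual [PMF.pure_apply]

/-- Maximum principle: started at a maximiser `m`, the nonnegative variable `φ m - φ S_t` has mean
zero, hence vanishes almost surely, while every state is reached with positive probability at some
time. -/
theorem IsIrreducible.eq_of_stateOp_eq (hirr : M.IsIrreducible π) {φ : 𝒮 → ℝ}
    (h : M.stateOp π φ = φ) (s s' : 𝒮) : φ s = φ s' := by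
  have : Nonempty 𝒮 := ⟨s⟩
  obtain ⟨m, hm⟩ := Finite.exists_max φ
  suffices ∀ s', φ s' = φ m by rw [this s, this s']
  intro s'
  by_contra hne
  obtain ⟨t, ht⟩ := hirr m s'
  have hint : Integrable (fun ω : ℕ → 𝒮 × 𝒜 => φ m - φ (ω t).1) (M.trajState π m) :=
    M.integrable_comp_coord π _ t fun x => φ m - φ x.1
  have h0 : ∫ ω, (φ m - φ (ω t).1) ∂(M.trajState π m) = 0 := by
    have hi : Integrable (fun ω : ℕ → 𝒮 × 𝒜 => φ (ω t).1) (M.trajState π m) :=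
      M.integrable_comp_coord π _ t fun x => φ x.1
    rw [integral_sub (integrable_const _) hi, integral_trajState, Function.iterate_fixed h]
    simp
  rw [integral_eq_zero_iff_of_nonneg (fun ω => sub_nonneg.2 (hm _)) hint] at h0
  refine ht.ne' (measure_mono_null ?_ (ae_iff.1 h0))
  rintro ω rfl
  simpa [sub_eq_zero] using Ne.symm hne

/-- Some `s₀` carries mass, and `t` steps of the chain, which preserve `d`, transport part of it to
`s`. -/
theorem IsIrreducible.pos (hirr : M.IsIrreducible π) {d : 𝒮 → ℝ} (hd : M.IsStationary π d)
    (s : 𝒮) : 0 < d s := by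
  classical
  obtain ⟨s₀, h₀⟩ : ∃ s₀, 0 < d s₀ := by
    by_contra! h
    have := Finset.sum_nonpos fun s (_ : s ∈ Finset.univ) => h s
    rw [hd.1.2] at this
    linarith
  obtain ⟨t, ht⟩ := hirr s₀ s
  set φ : 𝒮 → ℝ := Set.indicator {s} 1 with hφ
  have hφ_eq : ∀ s₁, (M.stateOp π)^[t] φ s₁ = (M.trajState π s₁).real {ω | (ω t).1 = s} := by
    intro s₁
    have hm : MeasurableSet {ω : ℕ → 𝒮 × 𝒜 | (ω t).1 = s} :=
      (measurable_fst.comp (measurable_pi_apply t)) (measurableSet_singleton s)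
    rw [← integral_trajState, ← integral_indicator_one hm]
    rfl
  have hsum := hd.sum_mul_iterate_stateOp φ t
  have hd_eq : ∑ s', d s' * φ s' = d s := by simp [hφ, Pi.single_apply]
  rw [← hd_eq, ← hsum]
  refine Finset.sum_pos' (fun s₁ _ => ?_) ⟨s₀, Finset.mem_univ _, ?_⟩
  · rw [hφ_eq]
    exact mul_nonneg (hd.1.1 s₁) measureReal_nonneg
  · rw [hφ_eq]
    exact mul_pos h₀ (ENNReal.toReal_pos ht.ne' (measure_ne_top _ _))

/-- The Poisson equation is solvable for functions of mean zero. -/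
theorem IsIrreducible.exists_sub_stateOp_eq (hirr : M.IsIrreducible π) {d : 𝒮 → ℝ}
    (hd : M.IsStationary π d) {f : 𝒮 → ℝ} (hf : ∑ s, d s * f s = 0) :
    ∃ g : 𝒮 → ℝ, ∀ s, g s - M.stateOp π g s = f s := by
  -- `1 - P` kills constants; adding the `d`-mean removes this kernel, so in finite dimension `L` is
  -- bijective. As `L` preserves `d`-means, the extra term vanishes when `f` has mean zero.
  let L : (𝒮 → ℝ) →ₗ[ℝ] (𝒮 → ℝ) :=
    { toFun := fun g s => g s - M.stateOp π g s + ∑ s', d s' * g s'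
      map_add' := fun g g' => by
        ext s
        simp only [stateOp_apply, Pi.add_apply, mul_add, Finset.sum_add_distrib]
        ring
      map_smul' := fun c g => by
        ext s
        simp only [stateOp_apply, Pi.smul_apply, smul_eq_mul, mul_left_comm _ c,
          ← Finset.mul_sum, RingHom.id_apply]
        ring }
  have hmean : ∀ g, ∑ s, d s * L g s = ∑ s, d s * g s := fun g => by
    change ∑ s, d s * (g s - M.stateOp π g s + ∑ s', d s' * g s') = _
    simp only [mul_add, mul_sub, Finset.sum_add_distrib, Finset.sum_sub_distrib]
    rw [hd.sum_mul_stateOp, ← Finset.sum_mul, hd.1.2]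
    ring
  have hinj : Function.Injective L := by
    rw [injective_iff_map_eq_zero]
    intro g hg
    have hg0 : ∑ s, d s * g s = 0 := by rw [← hmean, hg]; simp
    have hharm : M.stateOp π g = g := by
      ext s
      have : g s - M.stateOp π g s + ∑ s', d s' * g s' = 0 := congrFun hg s
      linarith
    ext s
    have hc : ∑ s', d s' * g s' = g s := by
      simp only [fun s' => hirr.eq_of_stateOp_eq hharm s' s]
      rw [← Finset.sum_mul, hd.1.2, one_mul]
    rw [← hc, hg0, Pi.zero_apply]
  obtain ⟨g, hg⟩ := LinearMap.injective_iff_surjective.1 hinj f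
  refine ⟨g, fun s => ?_⟩
  have h1 : g s - M.stateOp π g s + ∑ s', d s' * g s' = f s := congrFun hg s
  rw [← hmean, hg, hf] at h1
  linarith

/-- Solve the Poisson equation for the indicator of `s` centred by `d s`; any stationary `d'`
annihilates its left side, which forces `d' s = d s`. -/
theorem IsIrreducible.isStationary_unique (hirr : M.IsIrreducible π) {d d' : 𝒮 → ℝ}
    (hd : M.IsStationary π d) (hd' : M.IsStationary π d') : d' = d := by
  classical
  ext s
  obtain ⟨g, hg⟩ := hirr.exists_sub_stateOp_eq hd (f := fun s' => (if s' = s then 1 else 0) - d s) (by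
    simp [mul_sub, Finset.sum_sub_distrib, ← Finset.sum_mul, hd.1.2])
  have h : ∑ s', d' s' * ((if s' = s then 1 else 0) - d s) = 0 := by
    simp only [← hg, mul_sub, Finset.sum_sub_distrib, hd'.sum_mul_stateOp, sub_self]
  simpa [mul_sub, Finset.sum_sub_distrib, ← Finset.sum_mul, hd'.1.2, sub_eq_zero] using h

/-- The same decision process with another reward. -/
def withReward {𝒮 𝒜 : Type*} (M : MDP 𝒮 𝒜) (r : 𝒮 → 𝒜 → ℝ) : MDP 𝒮 𝒜 := { M with r := r }

-- With the indicator of `s` as reward, the objective is `d s`. The right side does not involve `d`,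
-- which yields uniqueness.
open Classical in
theorem IsDiscountedStationary.eq_J {d : 𝒮 → ℝ} (hd : M.IsDiscountedStationary π d) (s : 𝒮) :
    d s = (M.withReward fun s' _ => if s' = s then 1 else 0).J π := by
  have h : (M.withReward fun s' _ => if s' = s then 1 else 0).IsDiscountedStationary π d := hd
  rw [← h.sum_mul_expAct]
  simp [withReward, expAct_comp_fst π (fun s' => if s' = s then (1 : ℝ) else 0)]

theorem isDiscountedStationary_unique {d d' : 𝒮 → ℝ} (hd : M.IsDiscountedStationary π d)
    (hd' : M.IsDiscountedStationary π d') : d' = d :=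
  funext fun s => by rw [hd.eq_J, hd'.eq_J]

end Irreducible

/-! ### Exponential concentration for additive functionals -/

section Concentration

variable {𝒮 𝒜 : Type*} [Fintype 𝒮] [Fintype 𝒜] (M : MDP 𝒮 𝒜) (π : Policy 𝒮 𝒜)

/-- With `u = l (g - m)`, where `m` is the one-step mean, `exp u ≤ 1 + u + u ^ 2` for `|u| ≤ 1`; the
linear term averages to zero. -/
theorem stepOp_exp_le {g : 𝒮 × 𝒜 → ℝ} {C l : ℝ} (hg : ∀ x, |g x| ≤ C) (hl : 0 ≤ l)
    (hlC : l * (2 * C) ≤ 1) (x : 𝒮 × 𝒜) :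
    M.stepOp π (fun y => Real.exp (l * g y)) x ≤
      Real.exp (l * M.stepOp π g x + (l * (2 * C)) ^ 2) := by
  have hK : |M.stepOp π g x| ≤ C := M.abs_iterate_stepOp_le π hg 1 x
  set m := M.stepOp π g x with hm
  set w : 𝒮 × 𝒜 → ℝ := fun y => (withAction π (M.p x.1 x.2) y).toReal with hw
  have hw0 : ∀ y, 0 ≤ w y := fun _ => ENNReal.toReal_nonneg
  have hw1 : ∑ y, w y = 1 := sum_toReal_eq_one _
  have hwm : ∑ y, w y * g y = m := (M.stepOp_eq_sum π g x).symm
  rw [stepOp_eq_sum, Real.exp_add]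
  have hu : ∀ y, |l * (g y - m)| ≤ l * (2 * C) := fun y => by
    rw [abs_mul, abs_of_nonneg hl]
    refine mul_le_mul_of_nonneg_left ?_ hl
    linarith [abs_sub (g y) m, hg y]
  calc ∑ y, w y * Real.exp (l * g y)
      = Real.exp (l * m) * ∑ y, w y * Real.exp (l * (g y - m)) := by
        rw [Finset.mul_sum]
        refine Finset.sum_congr rfl fun y _ => ?_
        rw [mul_left_comm, ← Real.exp_add]
        ring_nf
    _ ≤ Real.exp (l * m) * ∑ y, w y * (1 + l * (g y - m) + (l * (2 * C)) ^ 2) := by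
        refine mul_le_mul_of_nonneg_left (Finset.sum_le_sum fun y _ => ?_) (Real.exp_pos _).le
        refine mul_le_mul_of_nonneg_left ?_ (hw0 y)
        have h1 := (abs_le.1 (Real.abs_exp_sub_one_sub_id_le ((hu y).trans hlC))).2
        have h2 : (l * (g y - m)) ^ 2 ≤ (l * (2 * C)) ^ 2 := sq_le_sq' (abs_le.1 (hu y)).1
          (abs_le.1 (hu y)).2
        linarith
    _ = Real.exp (l * m) * (1 + (l * (2 * C)) ^ 2) := by
        congr 1
        have : ∀ y, w y * (1 + l * (g y - m) + (l * (2 * C)) ^ 2) =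
            w y * (1 + (l * (2 * C)) ^ 2 - l * m) + l * (w y * g y) := fun y => by ring
        simp only [this, Finset.sum_add_distrib, ← Finset.sum_mul, ← Finset.mul_sum, hw1, hwm]
        ring
    _ ≤ _ := by
        refine mul_le_mul_of_nonneg_left ?_ (Real.exp_pos _).le
        rw [add_comm]
        exact Real.add_one_le_exp _

variable [MeasurableSpace 𝒮] [DiscreteMeasurableSpace 𝒮]
  [MeasurableSpace 𝒜] [DiscreteMeasurableSpace 𝒜]

theorem integrable_comp_history (μ : PMF (𝒮 × 𝒜)) (t : ℕ) (F : (Finset.Iic t → 𝒮 × 𝒜) → ℝ) :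
    Integrable (fun ω => F (Preorder.frestrictLe (π := fun _ => 𝒮 × 𝒜) t ω))
      (M.trajFrom π μ) := by
  obtain ⟨C, -, hC⟩ := exists_abs_le F
  have hF : Measurable F := .of_discrete
  exact Integrable.of_bound (C := C) (hF.comp (by fun_prop)).aestronglyMeasurable
    (Eventually.of_forall fun ω => hC _)

theorem sum_frestrictLe {X : Type*} (f : X → ℝ) (T : ℕ) (ω : ℕ → X) :
    ∑ i, f (Preorder.frestrictLe (π := fun _ => X) T ω i) = ∑ t ∈ Finset.range (T + 1), f (ω t) := by
  rw [Nat.range_succ_eq_Iic]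
  exact Finset.sum_coe_sort (Finset.Iic T) fun i => f (ω i)

/-- The exponent regroups as `g (ω 0)` plus the martingale increments `g (ω (t + 1)) - M.stepOp π g
(ω t)`. Conditioning on the history costs one factor `exp ((l * (2 * C)) ^ 2)` per step. -/
theorem integral_exp_le (μ : PMF (𝒮 × 𝒜)) {g : 𝒮 × 𝒜 → ℝ} {C l : ℝ} (hg : ∀ x, |g x| ≤ C)
    (hl : 0 ≤ l) (hlC : l * (2 * C) ≤ 1) (T : ℕ) :
    ∫ ω, Real.exp (l * (∑ t ∈ Finset.range T, (g (ω t) - M.stepOp π g (ω t)) + g (ω T)))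
      ∂(M.trajFrom π μ) ≤ Real.exp (l * C + (l * (2 * C)) ^ 2 * T) := by
  set f : 𝒮 × 𝒜 → ℝ := fun x => g x - M.stepOp π g x with hf
  induction T with
  | zero =>
    calc _ ≤ ∫ ω, Real.exp (l * C) ∂(M.trajFrom π μ) := by
          refine integral_mono ?_ (integrable_const _) fun ω => ?_
          · simpa using M.integrable_comp_coord π μ 0 fun x => Real.exp (l * g x)
          · simpa using mul_le_mul_of_nonneg_left (le_of_abs_le (hg (ω 0))) hl
      _ = _ := by simp
  | succ T ih =>
    let F : (Finset.Iic T → 𝒮 × 𝒜) → ℝ := fun h => Real.exp (l * ∑ i, f (h i))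
    let last : Finset.Iic T := ⟨T, Finset.mem_Iic.2 le_rfl⟩
    calc _ = ∫ ω, F (Preorder.frestrictLe (π := fun _ => 𝒮 × 𝒜) T ω) *
            Real.exp (l * g (ω (T + 1))) ∂(M.trajFrom π μ) := by
          refine integral_congr_ae (Eventually.of_forall fun ω => ?_)
          simp only [F, sum_frestrictLe]
          rw [← Real.exp_add, mul_add]
      _ = ∫ ω, F (Preorder.frestrictLe (π := fun _ => 𝒮 × 𝒜) T ω) *
            M.stepOp π (fun y => Real.exp (l * g y)) (ω T) ∂(M.trajFrom π μ) :=
          M.integral_history_mul_succ π μ T F fun y => Real.exp (l * g y)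
      _ ≤ ∫ ω, Real.exp ((l * (2 * C)) ^ 2) * Real.exp (l * (∑ t ∈ Finset.range T, f (ω t) +
            g (ω T))) ∂(M.trajFrom π μ) := by
          refine integral_mono
            (M.integrable_comp_history π μ T fun h => F h *
              M.stepOp π (fun y => Real.exp (l * g y)) (h last))
            ((M.integrable_comp_history π μ T fun h => Real.exp (l * (∑ i, f (h i) - f (h last) +
              g (h last)))).congr (Eventually.of_forall fun ω => ?_) |>.const_mul _) fun ω => ?_
          · simp only [sum_frestrictLe, Finset.sum_range_succ]
            simp [last]
          · simp only [F, sum_frestrictLe]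
            refine (mul_le_mul_of_nonneg_left (M.stepOp_exp_le π hg hl hlC (ω T))
              (Real.exp_pos _).le).trans_eq ?_
            rw [← Real.exp_add, ← Real.exp_add, Finset.sum_range_succ]
            congr 1
            simp only [hf]
            ring
      _ ≤ Real.exp ((l * (2 * C)) ^ 2) * Real.exp (l * C + (l * (2 * C)) ^ 2 * T) := by
          rw [integral_const_mul]
          exact mul_le_mul_of_nonneg_left ih (Real.exp_pos _).le
      _ = _ := by
          rw [← Real.exp_add]
          push_cast
          ring_nf

/-- Chernoff bound; dropping the boundary term `g (ω T)` costs the second `l * C`. -/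
theorem measureReal_sum_ge_le (μ : PMF (𝒮 × 𝒜)) {g : 𝒮 × 𝒜 → ℝ} {C l : ℝ}
    (hg : ∀ x, |g x| ≤ C) (hl : 0 ≤ l) (hlC : l * (2 * C) ≤ 1) (T : ℕ) (a : ℝ) :
    (M.trajFrom π μ).real {ω | a ≤ ∑ t ∈ Finset.range T, (g (ω t) - M.stepOp π g (ω t))} ≤
      Real.exp (2 * l * C + (l * (2 * C)) ^ 2 * T - l * a) := by
  set f : 𝒮 × 𝒜 → ℝ := fun x => g x - M.stepOp π g x with hf
  let last : Finset.Iic T := ⟨T, Finset.mem_Iic.2 le_rfl⟩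
  have hint : Integrable (fun ω : ℕ → 𝒮 × 𝒜 => Real.exp (l * ∑ t ∈ Finset.range T, f (ω t)))
      (M.trajFrom π μ) := by
    refine (M.integrable_comp_history π μ T fun h =>
      Real.exp (l * (∑ i, f (h i) - f (h last)))).congr (Eventually.of_forall fun ω => ?_)
    simp only [sum_frestrictLe, Finset.sum_range_succ]
    simp [last]
  have hint' : Integrable (fun ω : ℕ → 𝒮 × 𝒜 =>
      Real.exp (l * (∑ t ∈ Finset.range T, f (ω t) + g (ω T)))) (M.trajFrom π μ) := by
    refine (M.integrable_comp_history π μ T fun h =>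
      Real.exp (l * (∑ i, f (h i) - f (h last) + g (h last)))).congr
        (Eventually.of_forall fun ω => ?_)
    simp only [sum_frestrictLe, Finset.sum_range_succ]
    simp [last]
  have hmgf : mgf (fun ω : ℕ → 𝒮 × 𝒜 => ∑ t ∈ Finset.range T, f (ω t)) (M.trajFrom π μ) l ≤
      Real.exp (l * C) * Real.exp (l * C + (l * (2 * C)) ^ 2 * T) := by
    refine le_trans ?_ (mul_le_mul_of_nonneg_left (M.integral_exp_le π μ hg hl hlC T)
      (Real.exp_pos _).le)
    rw [mgf, ← integral_const_mul]
    refine integral_mono hint (hint'.const_mul _) fun ω => ?_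
    simp only []
    rw [← Real.exp_add]
    refine Real.exp_le_exp.2 ?_
    have := mul_le_mul_of_nonneg_left (abs_le.1 (hg (ω T))).1 hl
    linarith
  refine (measure_ge_le_exp_mul_mgf a hl hint).trans
    ((mul_le_mul_of_nonneg_left hmgf (Real.exp_pos _).le).trans_eq ?_)
  rw [← Real.exp_add, ← Real.exp_add]
  ring_nf

theorem tendsto_mul_measureReal_sum_ge (μ : PMF (𝒮 × 𝒜)) (g : 𝒮 × 𝒜 → ℝ) {ε : ℝ} (hε : 0 < ε) :
    Tendsto (fun T : ℕ => (T : ℝ) * (M.trajFrom π μ).real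
      {ω | ε * T ≤ ∑ t ∈ Finset.range T, (g (ω t) - M.stepOp π g (ω t))}) atTop (𝓝 0) := by
  obtain ⟨C', hC', hg'⟩ := exists_abs_le g
  obtain ⟨C, hC, hg⟩ : ∃ C : ℝ, 0 < C ∧ ∀ x, |g x| ≤ C :=
    ⟨C' + 1, by linarith, fun x => (hg' x).trans (by linarith)⟩
  -- The first entry permits the exponential estimate; the second makes the quadratic cost at most
  -- half of the linear gain `l * ε` per step.
  set l := min (1 / (2 * C)) (ε / (8 * C ^ 2)) with hl_def
  have hl : 0 < l := lt_min (by positivity) (by positivity)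
  have hlC : l * (2 * C) ≤ 1 := by
    rw [← le_div_iff₀ (by positivity)]
    exact min_le_left _ _
  have hlε : (l * (2 * C)) ^ 2 ≤ l * ε / 2 := by
    have : l * (8 * C ^ 2) ≤ ε := by
      rw [← le_div_iff₀ (by positivity)]
      exact min_le_right _ _
    nlinarith
  set r := Real.exp (-(l * ε / 2)) with hr
  have hr1 : r < 1 := Real.exp_lt_one_iff.2 (by linarith [mul_pos hl hε])
  have hlim : Tendsto (fun T : ℕ => Real.exp (2 * l * C) * (T * r ^ T)) atTop (𝓝 0) := by
    simpa using (tendsto_self_mul_const_pow_of_lt_one (Real.exp_pos _).le hr1).const_mul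
      (Real.exp (2 * l * C))
  refine squeeze_zero (fun T => by positivity) (fun T => ?_) hlim
  rw [mul_left_comm]
  refine mul_le_mul_of_nonneg_left ?_ (Nat.cast_nonneg T)
  refine (M.measureReal_sum_ge_le π μ hg hl.le hlC T _).trans ?_
  rw [hr, ← Real.exp_nat_mul, ← Real.exp_add]
  refine Real.exp_le_exp.2 ?_
  have := mul_le_mul_of_nonneg_right hlε (Nat.cast_nonneg (α := ℝ) T)
  nlinarith

end Concentration

/-! ### Convergence of the averaging correction -/

section AveragingCorrection

variable {𝒮 𝒜 : Type*}

open Classical in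
/-- The indicator of the state `s` on state-action pairs. -/
noncomputable def atState (s : 𝒮) (x : 𝒮 × 𝒜) : ℝ := if x.1 = s then 1 else 0

theorem atState_nonneg (s : 𝒮) (x : 𝒮 × 𝒜) : 0 ≤ atState s x := by
  unfold atState; split_ifs <;> norm_num

theorem atState_le_one (s : 𝒮) (x : 𝒮 × 𝒜) : atState s x ≤ 1 := by
  unfold atState; split_ifs <;> norm_num

variable {M : MDP 𝒮 𝒜}

variable (M) in
/-- The discounted number of visits to `s` before time `T`. -/
noncomputable def discountedVisits (T : ℕ) (s : 𝒮) (ω : ℕ → 𝒮 × 𝒜) : ℝ :=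
  ∑ t ∈ Finset.range T, M.γ ^ t * atState s (ω t)

/-- The number of visits to `s` before time `T`. -/
noncomputable def visits (T : ℕ) (s : 𝒮) (ω : ℕ → 𝒮 × 𝒜) : ℝ :=
  ∑ t ∈ Finset.range T, atState s (ω t)

theorem discountedVisits_nonneg (T : ℕ) (s : 𝒮) (ω : ℕ → 𝒮 × 𝒜) :
    0 ≤ M.discountedVisits T s ω :=
  Finset.sum_nonneg fun t _ => mul_nonneg (pow_nonneg M.γ_pos.le t) (atState_nonneg s _)

theorem discountedVisits_le_visits (T : ℕ) (s : 𝒮) (ω : ℕ → 𝒮 × 𝒜) :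
    M.discountedVisits T s ω ≤ visits T s ω :=
  Finset.sum_le_sum fun _ _ => mul_le_of_le_one_left (atState_nonneg s _)
    (pow_le_one₀ M.γ_pos.le M.γ_lt_one.le)

theorem one_sub_mul_discountedVisits_le (T : ℕ) (s : 𝒮) (ω : ℕ → 𝒮 × 𝒜) :
    (1 - M.γ) * M.discountedVisits T s ω ≤ 1 := by
  have h : M.discountedVisits T s ω ≤ ∑ t ∈ Finset.range T, M.γ ^ t :=
    Finset.sum_le_sum fun t _ => mul_le_of_le_one_right (pow_nonneg M.γ_pos.le t)
      (atState_le_one s _)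
  have h1 : 0 ≤ 1 - M.γ := sub_nonneg.2 M.γ_lt_one.le
  refine (mul_le_mul_of_nonneg_left h h1).trans ?_
  rw [mul_neg_geom_sum]
  linarith [pow_nonneg M.γ_pos.le T]

/-- On trajectories with visit frequency near `d`, the averaged discounted frequency is near the
discounted frequency divided by `d`. -/
theorem abs_correction_sub_le {d ε : ℝ} (hd : 0 < d) (hε : ε ≤ d / 2) {T : ℕ}
    (hT : 0 < T) {s : 𝒮} {ω : ℕ → 𝒮 × 𝒜} (h : |visits T s ω - d * T| < ε * T) :
    |(1 - M.γ) * T * (M.discountedVisits T s ω / visits T s ω) -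
      (1 - M.γ) * M.discountedVisits T s ω / d| ≤ 2 * ε / d ^ 2 := by
  have hT' : (0 : ℝ) < T := Nat.cast_pos.2 hT
  set N := visits T s ω
  set Z := (1 - M.γ) * M.discountedVisits T s ω with hZ
  have hZ0 : 0 ≤ Z := mul_nonneg (sub_nonneg.2 M.γ_lt_one.le) (discountedVisits_nonneg T s ω)
  have hZ1 : Z ≤ 1 := one_sub_mul_discountedVisits_le T s ω
  have hN : d / 2 * T ≤ N := by
    have := (abs_lt.1 h).1
    nlinarith
  have hN0 : 0 < N := lt_of_lt_of_le (by positivity) hN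
  have e : (1 - M.γ) * T * (M.discountedVisits T s ω / N) - Z / d =
      Z * ((d * T - N) / (N * d)) := by
    rw [hZ]
    field_simp
  rw [e, abs_mul, abs_of_nonneg hZ0, abs_div, abs_of_pos (mul_pos hN0 hd), abs_sub_comm]
  calc Z * (|N - d * T| / (N * d)) ≤ 1 * (ε * T / (d / 2 * T * d)) := by
        have := (abs_nonneg _).trans h.le
        gcongr
    _ = 2 * ε / d ^ 2 := by field_simp

/-- The crude bound for atypical trajectories: the quotient of visit counts lies in `[0, 1]`, also
when it is `0 / 0`. -/
theorem abs_correction_sub_le_add {d : ℝ} (hd : 0 < d) (T : ℕ) (s : 𝒮) (ω : ℕ → 𝒮 × 𝒜) :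
    |(1 - M.γ) * T * (M.discountedVisits T s ω / visits T s ω) -
      (1 - M.γ) * M.discountedVisits T s ω / d| ≤ T + 1 / d := by
  have h0 := discountedVisits_nonneg (M := M) T s ω
  have h1 : 0 ≤ 1 - M.γ := sub_nonneg.2 M.γ_lt_one.le
  have hq : M.discountedVisits T s ω / visits T s ω ≤ 1 :=
    div_le_one_of_le₀ (discountedVisits_le_visits T s ω)
      (h0.trans (discountedVisits_le_visits T s ω))
  have hq0 : 0 ≤ M.discountedVisits T s ω / visits T s ω :=
    div_nonneg h0 (h0.trans (discountedVisits_le_visits T s ω))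
  have hA : (1 - M.γ) * T * (M.discountedVisits T s ω / visits T s ω) ≤ T :=
    calc _ ≤ 1 * (T : ℝ) * 1 := by
          gcongr
          linarith [M.γ_pos]
      _ = T := by ring
  have hA0 : 0 ≤ (1 - M.γ) * T * (M.discountedVisits T s ω / visits T s ω) := by positivity
  have hB : (1 - M.γ) * M.discountedVisits T s ω / d ≤ 1 / d := by
    gcongr
    exact one_sub_mul_discountedVisits_le T s ω
  have hB0 : 0 ≤ (1 - M.γ) * M.discountedVisits T s ω / d := by positivity
  rw [abs_le]
  constructor <;> linarith

variable [Fintype 𝒮] [Fintype 𝒜] {π : Policy 𝒮 𝒜}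

theorem stepOp_neg (ψ : 𝒮 × 𝒜 → ℝ) (x : 𝒮 × 𝒜) :
    M.stepOp π (fun y => -ψ y) x = -M.stepOp π ψ x := by
  simp [stepOp_eq_sum]

/-- Lifts a Poisson solution from states to state-action pairs: the action average of the lift is
`g` again. -/
theorem sub_stepOp_eq_of_sub_stateOp_eq {f g : 𝒮 → ℝ} (hg : ∀ s, g s - M.stateOp π g s = f s)
    (x : 𝒮 × 𝒜) :
    (fun y : 𝒮 × 𝒜 => f y.1 + M.expNext g y) x -
      M.stepOp π (fun y => f y.1 + M.expNext g y) x = f x.1 := by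
  have : expAct π (fun y => f y.1 + M.expNext g y) = g := by
    ext s
    rw [expAct_add, expAct_comp_fst, ← hg s, stateOp]
    ring
  rw [stepOp, this]
  ring

variable [MeasurableSpace 𝒮] [DiscreteMeasurableSpace 𝒮]
  [MeasurableSpace 𝒜] [DiscreteMeasurableSpace 𝒜]

@[fun_prop]
theorem measurable_atState_coord (s : 𝒮) (t : ℕ) :
    Measurable fun ω : ℕ → 𝒮 × 𝒜 => atState s (ω t) :=
  (Measurable.of_discrete (f := atState s)).comp (measurable_pi_apply t)

@[fun_prop]
theorem measurable_visits (T : ℕ) (s : 𝒮) :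
    Measurable (visits (𝒜 := 𝒜) T s) := by
  unfold visits; fun_prop

@[fun_prop]
theorem measurable_discountedVisits (T : ℕ) (s : 𝒮) :
    Measurable (M.discountedVisits T s) := by
  unfold discountedVisits; fun_prop

theorem IsIrreducible.tendsto_mul_measureReal_visits (hirr : M.IsIrreducible π) {d : 𝒮 → ℝ}
    (hd : M.IsStationary π d) (s : 𝒮) {ε : ℝ} (hε : 0 < ε) :
    Tendsto (fun T : ℕ => (T : ℝ) * (M.traj π).real {ω | ε * T ≤ |visits T s ω - d s * T|})
      atTop (𝓝 0) := by
  classical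
  set f : 𝒮 → ℝ := fun s' => (if s' = s then 1 else 0) - d s with hf
  obtain ⟨g, hg⟩ := hirr.exists_sub_stateOp_eq hd (f := f) (by
    simp [hf, mul_sub, Finset.sum_sub_distrib, ← Finset.sum_mul, hd.1.2])
  set G : 𝒮 × 𝒜 → ℝ := fun y => f y.1 + M.expNext g y with hG
  have hGf : ∀ x, G x - M.stepOp π G x = f x.1 := fun x => sub_stepOp_eq_of_sub_stateOp_eq hg x
  have hsum : ∀ T (ω : ℕ → 𝒮 × 𝒜), ∑ t ∈ Finset.range T, f (ω t).1 =
      visits T s ω - d s * T := fun T ω => by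
    simp only [hf, Finset.sum_sub_distrib, visits, atState]
    simp [mul_comm]
  have h1 := M.tendsto_mul_measureReal_sum_ge π (withAction π M.ρ) G hε
  have h2 := M.tendsto_mul_measureReal_sum_ge π (withAction π M.ρ) (fun x => -G x) hε
  simp only [stepOp_neg, neg_sub_neg, ← neg_sub (G _), hGf, Finset.sum_neg_distrib, hsum]
    at h1 h2
  refine squeeze_zero (fun T => by positivity) (fun T => ?_) (by simpa using h1.add h2)
  rw [← mul_add]
  refine mul_le_mul_of_nonneg_left ?_ (Nat.cast_nonneg T)
  refine le_trans (measureReal_mono ?_) (measureReal_union_le _ _)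
  intro ω hω
  simp only [Set.mem_ofPred_eq, Set.mem_union] at hω ⊢
  rwa [le_abs, neg_sub] at hω

theorem IsDiscountedStationary.tendsto_integral_discountedVisits {d : 𝒮 → ℝ}
    (hd : M.IsDiscountedStationary π d) (s : 𝒮) :
    Tendsto (fun T => ∫ ω, (1 - M.γ) * M.discountedVisits T s ω ∂(M.traj π)) atTop
      (𝓝 (d s)) := by
  have hJ : d s = ∫ ω, (1 - M.γ) * ∑' t : ℕ, M.γ ^ t * atState s (ω t) ∂(M.traj π) := by
    -- The trajectory law does not depend on the reward, so `rfl` closes the goal.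
    rw [hd.eq_J, J, integral_const_mul]
    rfl
  rw [hJ]
  refine tendsto_integral_of_dominated_convergence (fun _ => 1)
    (fun T => (by fun_prop : Measurable _).aestronglyMeasurable) (integrable_const _)
    (fun T => Eventually.of_forall fun ω => ?_) (Eventually.of_forall fun ω => ?_)
  · rw [Real.norm_eq_abs, abs_of_nonneg (mul_nonneg (sub_nonneg.2 M.γ_lt_one.le)
      (discountedVisits_nonneg T s ω))]
    exact one_sub_mul_discountedVisits_le T s ω
  · refine Tendsto.const_mul _ (Summable.hasSum ?_).tendsto_sum_nat
    refine Summable.of_nonneg_of_le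
      (fun t => mul_nonneg (pow_nonneg M.γ_pos.le t) (atState_nonneg s _))
      (fun t => mul_le_of_le_one_right (pow_nonneg M.γ_pos.le t) (atState_le_one s _))
      (summable_geometric_of_lt_one M.γ_pos.le M.γ_lt_one)

theorem IsIrreducible.tendsto_finiteCorrection (hirr : M.IsIrreducible π) {d dγ : 𝒮 → ℝ}
    (hd : M.IsStationary π d) (hdγ : M.IsDiscountedStationary π dγ) (s : 𝒮) :
    Tendsto (fun T => M.finiteCorrection π T s) atTop (𝓝 (dγ s / d s)) := by
  have hds := hirr.pos hd s
  set Y : ℕ → (ℕ → 𝒮 × 𝒜) → ℝ :=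
    fun T ω => (1 - M.γ) * T * (M.discountedVisits T s ω / visits T s ω) with hY
  set Z : ℕ → (ℕ → 𝒮 × 𝒜) → ℝ := fun T ω => (1 - M.γ) * M.discountedVisits T s ω / d s with hZ
  have hfin : ∀ T, M.finiteCorrection π T s = ∫ ω, Y T ω ∂(M.traj π) := fun T => rfl
  have hYm : ∀ T, Measurable (Y T) := fun T => by simp only [hY]; fun_prop
  have hZm : ∀ T, Measurable (Z T) := fun T => by simp only [hZ]; fun_prop
  have hZi : ∀ T, Integrable (Z T) (M.traj π) := fun T =>
    Integrable.of_bound (C := 1 / d s) (hZm T).aestronglyMeasurable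
      (Eventually.of_forall fun ω => by
        rw [Real.norm_eq_abs, abs_of_nonneg (div_nonneg (mul_nonneg
          (sub_nonneg.2 M.γ_lt_one.le) (discountedVisits_nonneg T s ω)) hds.le)]
        gcongr
        exact one_sub_mul_discountedVisits_le T s ω)
  have hYZi : ∀ T, Integrable (fun ω => Y T ω - Z T ω) (M.traj π) := fun T =>
    Integrable.of_bound (C := T + 1 / d s) ((hYm T).sub (hZm T)).aestronglyMeasurable
      (Eventually.of_forall fun ω => abs_correction_sub_le_add hds T s ω)
  have hZlim : Tendsto (fun T => ∫ ω, Z T ω ∂(M.traj π)) atTop (𝓝 (dγ s / d s)) := by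
    simp only [hZ, integral_div]
    exact (hdγ.tendsto_integral_discountedVisits s).div_const _
  suffices hdiff : Tendsto (fun T => ∫ ω, (Y T ω - Z T ω) ∂(M.traj π)) atTop (𝓝 0) by
    have := hdiff.add hZlim
    rw [zero_add] at this
    refine this.congr fun T => ?_
    rw [← integral_add (hYZi T) (hZi T), hfin]
    simp
  rw [Metric.tendsto_atTop]
  intro δ hδ
  -- The first entry keeps the visit count above `d s * T / 2`; the second keeps the typical error
  -- below `δ / 2`.
  set ε := min (d s / 2) (δ * d s ^ 2 / 8) with hε_def
  have hε : 0 < ε := lt_min (by positivity) (by positivity)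
  have hεd : 2 * ε / d s ^ 2 < δ / 2 := by
    rw [div_lt_iff₀ (by positivity)]
    have : ε ≤ δ * d s ^ 2 / 8 := min_le_right _ _
    nlinarith [mul_pos hδ (pow_pos hds 2)]
  -- For `T ≥ 1` the crude bound `T + 1 / d s` is at most `(1 + 1 / d s) * T`.
  have hlim := (hirr.tendsto_mul_measureReal_visits hd s hε).const_mul (1 + 1 / d s)
  rw [mul_zero] at hlim
  obtain ⟨T₀, hT₀⟩ := eventually_atTop.1 ((hlim.eventually_lt_const (half_pos hδ)).and
    (eventually_gt_atTop 0))
  refine ⟨T₀, fun T hT => ?_⟩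
  obtain ⟨hbad, hTpos⟩ := hT₀ T hT
  set B : Set (ℕ → 𝒮 × 𝒜) := {ω | ε * T ≤ |visits T s ω - d s * T|} with hB
  have hBm : MeasurableSet B := measurableSet_le (by fun_prop) (by fun_prop)
  have hT1 : (1 : ℝ) ≤ T := Nat.one_le_cast.2 hTpos
  have hpt : ∀ ω, ‖Y T ω - Z T ω‖ ≤ 2 * ε / d s ^ 2 + B.indicator (fun _ => T + 1 / d s) ω := by
    intro ω
    by_cases hω : ω ∈ B
    · rw [Set.indicator_of_mem hω]
      have := abs_correction_sub_le_add (M := M) hds T s ω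
      exact this.trans (le_add_of_nonneg_left (by positivity))
    · rw [Set.indicator_of_notMem hω, add_zero]
      exact abs_correction_sub_le hds (min_le_left _ _) hTpos (not_le.1 hω)
  rw [dist_zero_right]
  calc ‖∫ ω, (Y T ω - Z T ω) ∂(M.traj π)‖
      ≤ ∫ ω, (2 * ε / d s ^ 2 + B.indicator (fun _ => T + 1 / d s) ω) ∂(M.traj π) :=
        norm_integral_le_of_norm_le ((integrable_const _).add
          ((integrable_const _).indicator hBm)) (Eventually.of_forall hpt)
    _ = 2 * ε / d s ^ 2 + (T + 1 / d s) * (M.traj π).real B := by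
        rw [integral_add (integrable_const _) ((integrable_const _).indicator hBm),
          integral_indicator_const _ hBm]
        simp [mul_comm]
    _ ≤ 2 * ε / d s ^ 2 + (1 + 1 / d s) * (T * (M.traj π).real B) := by
        rw [← mul_assoc]
        gcongr
        rw [add_mul, one_mul]
        gcongr
        exact le_mul_of_one_le_right (by positivity) hT1
    _ < δ := by linarith

end AveragingCorrection

/-! ### Performance difference and the gradient -/

section Gradient

variable {𝒮 𝒜 : Type*} [Fintype 𝒮] [Fintype 𝒜] (M : MDP 𝒮 𝒜)

/-- Evaluate at a maximiser of `|w|`. The bound is uniform in the policy, as continuity in the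
parameter requires. -/
theorem abs_le_of_eq_add_stateOp {π : Policy 𝒮 𝒜} {b w : 𝒮 → ℝ} {B : ℝ} (hb : ∀ s, |b s| ≤ B)
    (h : ∀ s, w s = b s + M.γ * M.stateOp π w s) (s : 𝒮) : |w s| ≤ B / (1 - M.γ) := by
  have : Nonempty 𝒮 := ⟨s⟩
  obtain ⟨m, hm⟩ := Finite.exists_max fun s => |w s|
  have hP : |M.stateOp π w m| ≤ |w m| :=
    abs_sum_toReal_mul_le _ fun a => abs_sum_toReal_mul_le _ hm
  refine (hm s).trans ?_
  rw [le_div_iff₀ (sub_pos.2 M.γ_lt_one)]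
  have h1 : |w m| ≤ |b m| + M.γ * |M.stateOp π w m| := by
    conv_lhs => rw [h m]
    refine (abs_add_le _ _).trans_eq ?_
    rw [abs_mul, abs_of_pos M.γ_pos]
  have h2 := mul_le_mul_of_nonneg_left hP M.γ_pos.le
  linarith [hb m]

variable [MeasurableSpace 𝒮] [DiscreteMeasurableSpace 𝒮]
  [MeasurableSpace 𝒜] [DiscreteMeasurableSpace 𝒜]

/-- The one-step form of the performance difference identity. -/
theorem stateValue_sub (π π' : Policy 𝒮 𝒜) (s : 𝒮) :
    M.stateValue π' s - M.stateValue π s =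
      ∑ a, ((π' s a).toReal - (π s a).toReal) * M.q π' s a +
        M.γ * M.stateOp π (fun s' => M.stateValue π' s' - M.stateValue π s') s := by
  have h : ∀ a, M.q π' s a - M.q π s a =
      M.γ * M.expNext (fun s' => M.stateValue π' s' - M.stateValue π s') (s, a) := fun a => by
    rw [q_eq_add, q_eq_add]
    simp only [expNext, mul_sub, Finset.sum_sub_distrib]
    ring
  rw [stateOp, ← expAct_const_mul, expAct]
  simp only [← h]
  rw [stateValue, stateValue, expAct, expAct, ← Finset.sum_add_distrib, ← Finset.sum_sub_distrib]
  exact Finset.sum_congr rfl fun a _ => by ring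

variable {M}

/-- The performance difference identity. -/
theorem IsDiscountedStationary.J_sub_J {π : Policy 𝒮 𝒜} {d : 𝒮 → ℝ}
    (hd : M.IsDiscountedStationary π d) (π' : Policy 𝒮 𝒜) :
    M.J π' - M.J π =
      ∑ s, d s * ∑ a, ((π' s a).toReal - (π s a).toReal) * M.q π' s a := by
  rw [← hd.sum_mul_eq (v := fun s => M.stateValue π' s - M.stateValue π s) fun s => by
    rw [M.stateValue_sub π π' s, stateOp_apply]]
  simp only [J_eq_sum_stateValue, mul_sub, Finset.sum_sub_distrib]

theorem continuousAt_q {E : Type*} [TopologicalSpace E] {π : E → Policy 𝒮 𝒜} {θ : E}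
    (h : ∀ s a, ContinuousAt (fun ϑ => (π ϑ s a).toReal) θ) (s : 𝒮) (a : 𝒜) :
    ContinuousAt (fun ϑ => M.q (π ϑ) s a) θ := by
  -- The difference identity is used with `π θ` as the second policy, so `q` is frozen at `θ` and
  -- only the action probabilities vary.
  set b : E → 𝒮 → ℝ :=
    fun ϑ s => ∑ a, ((π θ s a).toReal - (π ϑ s a).toReal) * M.q (π θ) s a with hb
  have hB : Tendsto (fun ϑ => (∑ s, |b ϑ s|) / (1 - M.γ)) (𝓝 θ) (𝓝 0) := by
    have hc : ContinuousAt (fun ϑ => (∑ s, |b ϑ s|) / (1 - M.γ)) θ := by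
      simp only [hb]
      fun_prop
    simpa [hb, ContinuousAt] using hc
  have hv : ∀ s, ContinuousAt (fun ϑ => M.stateValue (π ϑ) s) θ := fun s => by
    rw [ContinuousAt, tendsto_iff_dist_tendsto_zero]
    refine squeeze_zero (fun _ => dist_nonneg) (fun ϑ => ?_) hB
    rw [dist_comm, Real.dist_eq]
    exact M.abs_le_of_eq_add_stateOp (w := fun s => M.stateValue (π θ) s - M.stateValue (π ϑ) s)
      (fun s => Finset.single_le_sum (f := fun s => |b ϑ s|) (fun _ _ => abs_nonneg _)
        (Finset.mem_univ s)) (M.stateValue_sub (π ϑ) (π θ)) s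
  simp only [q_eq_add, expNext]
  fun_prop

/-- Since `u x - u θ = O(x - θ)`, replacing `w x` by `w θ` costs only `o(x - θ)`; no derivative of
`w` is needed. -/
theorem hasFDerivAt_sub_mul_of_continuousAt {E : Type*} [NormedAddCommGroup E] [NormedSpace ℝ E]
    {u w : E → ℝ} {u' : E →L[ℝ] ℝ} {θ : E} (hu : HasFDerivAt u u' θ) (hw : ContinuousAt w θ) :
    HasFDerivAt (fun x => (u x - u θ) * w x) (w θ • u') θ := by
  have h1 : HasFDerivAt (fun x => w θ * (u x - u θ)) (w θ • u') θ :=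
    (hu.sub_const (u θ)).const_mul (w θ)
  have h2 : HasFDerivAt (fun x => (u x - u θ) * (w x - w θ)) (0 : E →L[ℝ] ℝ) θ := by
    have ho : (fun x => w x - w θ) =o[𝓝 θ] fun _ => (1 : ℝ) := by
      rw [Asymptotics.isLittleO_one_iff]
      simpa using hw.sub_const (w θ)
    refine .of_isLittleO ?_
    simpa using (hu.isBigO_sub.norm_right.mul_isLittleO ho)
  refine ((h1.add h2).congr_fderiv (add_zero _)).congr_of_eventuallyEq
    (Eventually.of_forall fun x => ?_)
  simp only [Pi.add_apply]
  ring

theorem IsDiscountedStationary.hasGradientAt_J {E : Type*} [NormedAddCommGroup E]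
    [InnerProductSpace ℝ E] [CompleteSpace E] {π : E → Policy 𝒮 𝒜} {θ : E}
    (hdiff : ∀ s a, DifferentiableAt ℝ (fun ϑ => (π ϑ s a).toReal) θ) {d : 𝒮 → ℝ}
    (hd : M.IsDiscountedStationary (π θ) d) :
    HasGradientAt (fun ϑ => M.J (π ϑ))
      (∑ s, d s • ∑ a, M.q (π θ) s a • gradient (fun ϑ => (π ϑ s a).toReal) θ) θ := by
  have hJ : (fun ϑ => M.J (π ϑ)) = fun ϑ => M.J (π θ) +
      ∑ s, d s * ∑ a, ((π ϑ s a).toReal - (π θ s a).toReal) * M.q (π ϑ) s a := by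
    ext ϑ
    rw [← hd.J_sub_J (π ϑ)]
    ring
  rw [hJ, hasGradientAt_iff_hasFDerivAt]
  simp only [map_sum, map_smulₛₗ, conj_trivial]
  refine HasFDerivAt.const_add _ (HasFDerivAt.fun_sum fun s _ => HasFDerivAt.const_mul
    (HasFDerivAt.fun_sum fun a _ => ?_) (d s))
  exact hasFDerivAt_sub_mul_of_continuousAt (hdiff s a).hasGradientAt.hasFDerivAt
    (continuousAt_q (fun s a => (hdiff s a).continuousAt) s a)

end Gradient

end MDP

/-! ### The extended policy gradient theorem -/

theorem mainTheorem1 {𝒮 𝒜 : Type*}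
    [Fintype 𝒮] [MeasurableSpace 𝒮] [DiscreteMeasurableSpace 𝒮]
    [Fintype 𝒜] [MeasurableSpace 𝒜] [DiscreteMeasurableSpace 𝒜]
    (M : MDP 𝒮 𝒜) {n : ℕ} (π : EuclideanSpace ℝ (Fin n) → Policy 𝒮 𝒜)
    (θ : EuclideanSpace ℝ (Fin n))
    (hdiff : ∀ s a, DifferentiableAt ℝ (fun ϑ => (π ϑ s a).toReal) θ)
    (hirr : M.IsIrreducible (π θ))
    (hrec : ∀ s, M.IsPositiveRecurrent (π θ) s) :
    (∃! d, M.IsStationary (π θ) d) ∧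
    (∃! d, M.IsDiscountedStationary (π θ) d) ∧
    ∀ d dγ : 𝒮 → ℝ, M.IsStationary (π θ) d → M.IsDiscountedStationary (π θ) dγ →
      (∀ s, 0 < d s ∧
        Tendsto (fun T => M.finiteCorrection (π θ) T s) atTop
          (𝓝 (M.averagingCorrection (π θ) s)) ∧
        M.averagingCorrection (π θ) s = dγ s / d s) ∧
      HasGradientAt (fun ϑ => M.J (π ϑ))
        (∑ s, dγ s • ∑ a, M.q (π θ) s a • gradient (fun ϑ => (π ϑ s a).toReal) θ) θ ∧
      ∑ s, dγ s • ∑ a, M.q (π θ) s a • gradient (fun ϑ => (π ϑ s a).toReal) θ =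
        ∑ s, d s • (M.averagingCorrection (π θ) s •
          ∑ a, M.q (π θ) s a • gradient (fun ϑ => (π ϑ s a).toReal) θ) := by
  have : Nonempty 𝒮 := M.ρ.support_nonempty.to_type
  obtain ⟨d₀, hd₀⟩ := M.exists_isStationary (π θ)
  obtain ⟨e₀, he₀⟩ := M.exists_isDiscountedStationary (π θ)
  refine ⟨⟨d₀, hd₀, fun d hd => hirr.isStationary_unique hd₀ hd⟩,
    ⟨e₀, he₀, fun d hd => MDP.isDiscountedStationary_unique he₀ hd⟩, fun d dγ hd hdγ => ?_⟩
  have hlim := hirr.tendsto_finiteCorrection hd hdγ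
  -- `limUnder` is meaningful only under convergence, which `hlim` supplies.
  have hc : ∀ s, M.averagingCorrection (π θ) s = dγ s / d s := fun s => (hlim s).limUnder_eq
  refine ⟨fun s => ⟨hirr.pos hd s, ?_, hc s⟩, hdγ.hasGradientAt_J hdiff,
    Finset.sum_congr rfl fun s _ => ?_⟩
  · rw [hc s]
    exact hlim s
  · rw [hc s, smul_smul, mul_div_cancel₀ _ (hirr.pos hd s).ne']
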